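/- Let $N\in\{1,2\}$, let $X$ be a metrizable topological space, and let $(\Phi(t))_{t\ge 0}$ be a continuous semiflow on $X$, i.e. $\Phi(0)=\mathrm{id}$, $\Phi(t_1+t_2)=\Phi(t_1)\circ\Phi(t_2)$ for all $t_1,t_2\ge 0$, and $(t,u)\mapsto\Phi(t)u$ is continuous on $[0,\infty)\times X$. Suppose that $(\Phi(t))_{t\ge0}$ is an extended dissipative system on $\mathbb{R}^N$: to each $u\in X$ are associated functions $e,d\in C^0(\mathbb{R}^N,\mathbb{R}_+)$ and $f\in C^0(\mathbb{R}^N,\mathbb{R}^N)$ such that (A1) $e,f,d$ depend continuously on $u\in X$, uniformly on compact subsets of $\mathbb{R}^N$; (A2) $|f|^2\le b(e)\,d$ on $\mathbb{R}^N$ for some nondecreasing function $b:\mathbb{R}_+\to\mathbb{R}_+$ independent of $u$; (A3) $d\equiv 0$ only if $\Phi(t)u=u$ for all $t\ge 0$; (A4) along every trajectory $u(t)=\Phi(t)u_0$, the corresponding functions $e(x,t),f(x,t),d(x,t)$ satisfy $\partial_t e=\operatorname{div} f-d$ in the sense of distributions on $\mathbb{R}^N\times(0,\infty)$. Suppose moreover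 that the system is bounded: there is $E>0$ such that $e(x)\le E$ for all $x\in\mathbb{R}^N$ and all $u\in X$. If $\bar u\in X$ is not an equilibrium point (that is, $\Phi(t)\bar u\ne\bar u$ for some $t\ge 0$), then $\bar u$ has an open neighbourhood $\mathcal{V}$ in $X$ such that every trajectory $u(t)=\Phi(t)u_0$, $u_0\in X$, satisfies $$\limsup_{T\to\infty}\frac{\Psi_N(T)}{T}\int_0^T \mathbf{1}_{\mathcal{V}}(u(t))\,dt<\infty,$$ where $\Psi_1(T)=\sqrt{T}$, $\Psi_2(T)=\log T$, and $\mathbf{1}_{\mathcal V}$ is the characteristic function of $\mathcal V$. -/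

import Mathlib

open scoped NNReal ContDiff Topology

/-- The distributional energy balance `∂ₜ e = div f - d` on `ℝᴺ × (0, ∞)`, for time-dependent
densities `e, d` and flux `f`: for every smooth `φ` with compact support in `ℝᴺ × (0, ∞)`,
`∬ (e ∂ₜφ - f · ∇ₓφ - d φ) dx dt = 0`.
The values of `e, f, d` at times `t ≤ 0` are irrelevant since `φ` vanishes there. -/
def EnergyBalance (N : ℕ)
    (e : ℝ → EuclideanSpace ℝ (Fin N) → ℝ)
    (f : ℝ → EuclideanSpace ℝ (Fin N) → EuclideanSpace ℝ (Fin N))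
    (d : ℝ → EuclideanSpace ℝ (Fin N) → ℝ) : Prop :=
  ∀ φ : EuclideanSpace ℝ (Fin N) × ℝ → ℝ,
    ContDiff ℝ ∞ φ → HasCompactSupport φ → (∀ p ∈ tsupport φ, 0 < p.2) →
      ∫ p : EuclideanSpace ℝ (Fin N) × ℝ,
        (e p.2 p.1 * fderiv ℝ φ p (0, 1) - fderiv ℝ φ p (f p.2 p.1, 0) - d p.2 p.1 * φ p) = 0

/-- An extended dissipative system on `ℝᴺ` with phase space `X`: a continuous semiflow on `X`
(a `Flow` with time monoid `ℝ≥0`), together with an energy density `e`, an energy flux `f` and an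
energy dissipation rate `d` attached to each `u : X`. The spaces of continuous maps `C(_, _)` carry
the topology of uniform convergence on compact sets. -/
structure ExtendedDissipativeSystem (N : ℕ) (X : Type*) [TopologicalSpace X] where
  /-- the continuous semiflow -/
  Φ : Flow ℝ≥0 X
  /-- the energy density -/
  e : X → C(EuclideanSpace ℝ (Fin N), ℝ≥0)
  /-- the energy flux -/
  f : X → C(EuclideanSpace ℝ (Fin N), EuclideanSpace ℝ (Fin N))
  /-- the energy dissipation rate -/
  d : X → C(EuclideanSpace ℝ (Fin N), ℝ≥0)
  continuous_e : Continuous e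
  continuous_f : Continuous f
  continuous_d : Continuous d
  flux_bound : ∃ b : ℝ≥0 → ℝ≥0, Monotone b ∧
    ∀ u x, ‖f u x‖ ^ 2 ≤ (b (e u x) : ℝ) * (d u x : ℝ)
  eq_of_dissipation_zero : ∀ u, (∀ x, d u x = 0) → ∀ t, Φ t u = u
  energy_balance : ∀ u₀, EnergyBalance N
    (fun t x => (e (Φ t.toNNReal u₀) x : ℝ))
    (fun t x => f (Φ t.toNNReal u₀) x)
    (fun t x => (d (Φ t.toNNReal u₀) x : ℝ))

namespace ExtendedDissipativeSystem

/-- The system is bounded: the energy density is bounded uniformly in space and over `X`. -/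
def IsBounded {N : ℕ} {X : Type*} [TopologicalSpace X]
    (S : ExtendedDissipativeSystem N X) : Prop :=
  ∃ E : ℝ, 0 < E ∧ ∀ u x, (S.e u x : ℝ) ≤ E

/-- `u` is an equilibrium point of the semiflow. -/
def IsEquilibrium {N : ℕ} {X : Type*} [TopologicalSpace X]
    (S : ExtendedDissipativeSystem N X) (u : X) : Prop :=
  ∀ t, S.Φ t u = u

end ExtendedDissipativeSystem

/-- `Ψ₁(T) = √T` and `Ψ₂(T) = log T`; only the values for `N = 1, 2` are meaningful. -/
noncomputable def Psi : ℕ → ℝ → ℝ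
  | 1, T => √T
  | 2, T => Real.log T
  | _, _ => 1

open MeasureTheory Metric Set Filter

/-! By (A3) a non-equilibrium dissipates at some point `x₀`; take `V` to be the states dissipating
more than a suitable `δ > 0` on a small closed ball around `x₀`. This is open since the ball is
compact.

Test the energy balance with `η(x)² θ(t)`, where `θ` is about the indicator of `[0, T]`. By (A2) and
boundedness, `|f|² ≤ B d` with `B = b(E)`, so Young's inequality absorbs the flux term into half of
the dissipation. If `η = 1` on the ball, the time spent in `V` is at most a constant times `∫ η² + T
∫ |∇η|²` (`EnergyBalance.measure_dissipation_le`).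

It remains to choose `η` depending on `T` (`exists_cutoff`). This is where `N ≤ 2` enters: a ball
then has zero capacity, so the Dirichlet energy can tend to zero. For `N = 1` a bump of width `√T`
has mass of order `√T` and energy of order `1 / √T`. For `N = 2` a logarithmic cutoff has energy of
order `1 / log T` and support of area of order `√T`. Either way the bound is `O(T / Ψ_N(T))`. -/

theorem Real.smoothTransition.deriv_eq_zero {x : ℝ} (hx : x ∉ Icc (0 : ℝ) 1) :
    deriv Real.smoothTransition x = 0 := by
  rcases lt_or_ge x 0 with hx0 | hx0
  · have : Real.smoothTransition =ᶠ[𝓝 x] fun _ => 0 := by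
      filter_upwards [Iio_mem_nhds hx0] with y hy
      exact Real.smoothTransition.zero_of_nonpos (le_of_lt hy)
    rw [this.deriv_eq]
    simp
  · have : Real.smoothTransition =ᶠ[𝓝 x] fun _ => 1 := by
      filter_upwards [Ioi_mem_nhds (not_le.1 fun h => hx ⟨hx0, h⟩)] with y hy
      exact Real.smoothTransition.one_of_one_le (le_of_lt hy)
    rw [this.deriv_eq]
    simp

theorem Real.smoothTransition.exists_abs_deriv_le :
    ∃ M, 0 < M ∧ ∀ x, |deriv Real.smoothTransition x| ≤ M := by
  have hc : Continuous (deriv Real.smoothTransition) :=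
    (Real.smoothTransition.contDiff (n := 1)).continuous_deriv le_rfl
  obtain ⟨M, hM⟩ := isCompact_Icc.exists_bound_of_continuousOn (s := Icc (0 : ℝ) 1) hc.continuousOn
  refine ⟨max M 1, by positivity, fun x => ?_⟩
  by_cases hx : x ∈ Icc (0 : ℝ) 1
  · exact (hM x hx).trans (le_max_left _ _)
  · rw [Real.smoothTransition.deriv_eq_zero hx, abs_zero]
    positivity

/-! ### Spatial cutoffs built from a height function -/

section Cutoff

variable {F : Type*}

/-- The function equal to `1` where `h ≤ 1 / 2` and to `0` where `1 ≤ h`. -/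
noncomputable def smoothCutoff (h : F → ℝ) (x : F) : ℝ := Real.smoothTransition (2 - 2 * h x)

theorem smoothCutoff_nonneg (h : F → ℝ) (x : F) : 0 ≤ smoothCutoff h x :=
  Real.smoothTransition.nonneg _

theorem smoothCutoff_le_one (h : F → ℝ) (x : F) : smoothCutoff h x ≤ 1 :=
  Real.smoothTransition.le_one _

theorem smoothCutoff_eq_one {h : F → ℝ} {x : F} (hx : h x ≤ 1 / 2) : smoothCutoff h x = 1 :=
  Real.smoothTransition.one_of_one_le (by linarith)

theorem smoothCutoff_eq_zero {h : F → ℝ} {x : F} (hx : 1 ≤ h x) : smoothCutoff h x = 0 :=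
  Real.smoothTransition.zero_of_nonpos (by linarith)

variable [NormedAddCommGroup F]

theorem hasCompactSupport_smoothCutoff [ProperSpace F] {h : F → ℝ} {x₀ : F} {ρ : ℝ}
    (hρ : ∀ x, h x ≤ 1 → x ∈ closedBall x₀ ρ) : HasCompactSupport (smoothCutoff h) :=
  HasCompactSupport.intro (isCompact_closedBall x₀ ρ) fun _ hx =>
    smoothCutoff_eq_zero (not_le.1 fun hh => hx (hρ _ hh)).le

variable [NormedSpace ℝ F]

theorem contDiff_smoothCutoff {h : F → ℝ} (hh : ContDiff ℝ ∞ h) :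
    ContDiff ℝ ∞ (smoothCutoff h) :=
  (Real.smoothTransition.contDiff (n := ⊤)).comp (contDiff_const.sub (contDiff_const.mul hh))

theorem norm_fderiv_smoothCutoff_le {h : F → ℝ} (hh : ContDiff ℝ ∞ h) {M : ℝ}
    (hM : ∀ x, |deriv Real.smoothTransition x| ≤ M) (x : F) :
    ‖fderiv ℝ (smoothCutoff h) x‖ ≤ 2 * M * ‖fderiv ℝ h x‖ := by
  have h1 : HasFDerivAt h (fderiv ℝ h x) x := (hh.differentiable (by simp) x).hasFDerivAt
  have h2 : HasDerivAt Real.smoothTransition (deriv Real.smoothTransition (2 - 2 * h x))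
      (2 - 2 * h x) :=
    ((Real.smoothTransition.contDiff (n := 1)).differentiable (by simp) _).hasDerivAt
  have h3 : HasFDerivAt (smoothCutoff h) _ x :=
    h2.comp_hasFDerivAt x ((h1.const_mul 2).const_sub 2)
  rw [h3.fderiv, norm_smul, norm_neg, norm_smul, Real.norm_eq_abs, Real.norm_eq_abs, abs_two]
  have := mul_le_mul_of_nonneg_right (hM (2 - 2 * h x)) (norm_nonneg (fderiv ℝ h x))
  linarith

theorem fderiv_smoothCutoff_eq_zero {h : F → ℝ} (hh : Continuous h) {x : F} (hx : 1 < h x) :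
    fderiv ℝ (smoothCutoff h) x = 0 := by
  have : smoothCutoff h =ᶠ[𝓝 x] fun _ => 0 := by
    filter_upwards [hh.continuousAt.eventually (lt_mem_nhds hx)] with y hy
    exact smoothCutoff_eq_zero (le_of_lt hy)
  rw [this.fderiv_eq]
  simp

variable [FiniteDimensional ℝ F] [MeasurableSpace F] [BorelSpace F]
  (μ : Measure F) [μ.IsAddHaarMeasure]

theorem integral_smoothCutoff_sq_le {h : F → ℝ} {x₀ : F} {ρ : ℝ}
    (hρ : ∀ x, h x ≤ 1 → x ∈ closedBall x₀ ρ) :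
    ∫ x, smoothCutoff h x ^ 2 ∂μ ≤ μ.real (closedBall x₀ ρ) := by
  rw [← integral_indicator_one (μ := μ) (measurableSet_closedBall (x := x₀) (ε := ρ))]
  refine integral_mono_of_nonneg (.of_forall fun x => sq_nonneg _) ?_ (.of_forall fun x => ?_)
  · exact (integrable_indicator_iff measurableSet_closedBall).2
      (integrableOn_const measure_closedBall_lt_top.ne)
  · by_cases hx : x ∈ closedBall x₀ ρ
    · simpa [hx] using pow_le_one₀ (n := 2) (smoothCutoff_nonneg h x) (smoothCutoff_le_one h x)
    · simp [indicator_of_notMem hx,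
        smoothCutoff_eq_zero (not_le.1 fun hh => hx (hρ _ hh)).le]

/-- The gradient vanishes where `h > 1`, so only the ball contributes. The majorant `G` is constant
for the linear-scale cutoff and radially decaying for the logarithmic one. -/
theorem integral_norm_fderiv_smoothCutoff_sq_le {h : F → ℝ} (hh : ContDiff ℝ ∞ h) {x₀ : F} {ρ : ℝ}
    (hρ : ∀ x, h x ≤ 1 → x ∈ closedBall x₀ ρ) {G : F → ℝ} (hGc : Continuous G)
    (hG : ∀ x ∈ closedBall x₀ ρ, ‖fderiv ℝ h x‖ ^ 2 ≤ G x) {M : ℝ}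
    (hM : ∀ x, |deriv Real.smoothTransition x| ≤ M) :
    ∫ x, ‖fderiv ℝ (smoothCutoff h) x‖ ^ 2 ∂μ ≤ 4 * M ^ 2 * ∫ x in closedBall x₀ ρ, G x ∂μ := by
  rw [← integral_indicator measurableSet_closedBall, ← integral_const_mul]
  refine integral_mono_of_nonneg (.of_forall fun x => sq_nonneg _) ?_ (.of_forall fun x => ?_)
  · exact ((integrable_indicator_iff measurableSet_closedBall).2
      (hGc.continuousOn.integrableOn_compact (isCompact_closedBall x₀ ρ))).const_mul _
  · by_cases hx : x ∈ closedBall x₀ ρ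
    · simp only [indicator_of_mem hx]
      calc _ ≤ (2 * M * ‖fderiv ℝ h x‖) ^ 2 := by
            gcongr; exact norm_fderiv_smoothCutoff_le hh hM x
        _ = 4 * M ^ 2 * ‖fderiv ℝ h x‖ ^ 2 := by ring
        _ ≤ _ := by gcongr; exact hG x hx
    · simp [indicator_of_notMem hx,
        fderiv_smoothCutoff_eq_zero hh.continuous (not_le.1 fun hh => hx (hρ _ hh))]

end Cutoff

theorem norm_fderiv_norm_sub_sq {F : Type*} [NormedAddCommGroup F] [InnerProductSpace ℝ F]
    (x₀ x : F) : ‖fderiv ℝ (fun y => ‖y - x₀‖ ^ 2) x‖ = 2 * ‖x - x₀‖ := by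
  have : HasFDerivAt (fun y => ‖y - x₀‖ ^ 2) _ x := ((hasFDerivAt_id x).sub_const x₀).norm_sq
  rw [this.fderiv, ContinuousLinearMap.comp_id, ← Nat.cast_smul_eq_nsmul ℝ, norm_smul,
    innerSL_apply_norm]
  simp

/-- In polar coordinates the integrand becomes `y / (1 + y²)`, with primitive `log (1 + y²) / 2`.
This slow growth is what makes the planar logarithmic cutoff cheap; the `1 +` removes the
singularity at the centre. -/
theorem integral_inv_one_add_norm_sq_closedBall {F : Type*} [NormedAddCommGroup F]
    [NormedSpace ℝ F] [FiniteDimensional ℝ F] [Nontrivial F] [MeasurableSpace F] [BorelSpace F]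
    (μ : Measure F) [μ.IsAddHaarMeasure] (hF : Module.finrank ℝ F = 2) (x₀ : F)
    {ρ : ℝ} (hρ : 0 ≤ ρ) :
    ∫ x in closedBall x₀ ρ, (1 + ‖x - x₀‖ ^ 2)⁻¹ ∂μ
      = μ.real (ball 0 1) * Real.log (1 + ρ ^ 2) := by
  set g : ℝ → ℝ := (Iic ρ).indicator fun y => (1 + y ^ 2)⁻¹ with hg
  have h1 : ∀ x : F, (closedBall x₀ ρ).indicator (fun x => (1 + ‖x - x₀‖ ^ 2)⁻¹) x
      = g ‖x - x₀‖ := by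
    intro x
    simp [hg, indicator, dist_eq_norm]
  rw [← integral_indicator measurableSet_closedBall, integral_congr_ae (.of_forall h1),
    integral_sub_right_eq_self (fun x => g ‖x‖) x₀, integral_fun_norm_addHaar μ g, hF]
  have h2 : ∀ y, y ^ (2 - 1) • g y = (Iic ρ).indicator (fun y => y * (1 + y ^ 2)⁻¹) y := by
    intro y
    by_cases hy : y ∈ Iic ρ <;> simp [hg, hy]
  have h3 : ∫ y in (0 : ℝ)..ρ, y * (1 + y ^ 2)⁻¹ = Real.log (1 + ρ ^ 2) / 2 := by
    rw [intervalIntegral.integral_eq_sub_of_hasDerivAt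
      (f := fun y => Real.log (1 + y ^ 2) / 2) (f' := fun y => y * (1 + y ^ 2)⁻¹)]
    · simp
    · intro y _
      have := (((hasDerivAt_pow 2 y).const_add 1).log (by positivity)).div_const 2
      refine this.congr_deriv ?_
      push_cast
      ring
    · apply Continuous.intervalIntegrable
      exact continuous_id.mul (Continuous.inv₀ (by fun_prop) fun y => by positivity)
  simp_rw [h2]
  rw [setIntegral_indicator measurableSet_Iic, Ioi_inter_Iic,
    ← intervalIntegral.integral_of_le hρ, h3]
  simp only [nsmul_eq_mul, smul_eq_mul]
  push_cast
  ring

/-- Cutoff functions around a ball whose mass and Dirichlet energy are adapted to the time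
scale `T`. -/
theorem exists_cutoff {N : ℕ} (hN₁ : 1 ≤ N) (hN₂ : N ≤ 2) (x₀ : EuclideanSpace ℝ (Fin N))
    {r : ℝ} (hr : 0 < r) :
    ∃ C : ℝ, 0 < C ∧ ∀ᶠ T : ℝ in atTop, ∃ η : EuclideanSpace ℝ (Fin N) → ℝ,
      ContDiff ℝ ∞ η ∧ HasCompactSupport η ∧ (∀ x ∈ closedBall x₀ r, η x = 1) ∧
      Psi N T * ∫ x, η x ^ 2 ≤ C * T ∧ Psi N T * ∫ x, ‖fderiv ℝ η x‖ ^ 2 ≤ C := by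
  obtain ⟨M, hM0, hM⟩ := Real.smoothTransition.exists_abs_deriv_le
  have hq (x₀ : EuclideanSpace ℝ (Fin N)) : ContDiff ℝ ∞ fun x => ‖x - x₀‖ ^ 2 :=
    (contDiff_id.sub contDiff_const).norm_sq ℝ
  set v : ℝ := (volume : Measure (EuclideanSpace ℝ (Fin N))).real (ball 0 1) with hv
  have hv0 : 0 ≤ v := measureReal_nonneg
  obtain rfl | rfl : N = 1 ∨ N = 2 := by omega
  · refine ⟨v + 4 * M ^ 2 * (v * 4) + 1, by positivity, ?_⟩
    filter_upwards [eventually_gt_atTop 0, eventually_ge_atTop (2 * r ^ 2)] with T hT hTr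
    set h : EuclideanSpace ℝ (Fin 1) → ℝ := fun x => T⁻¹ * ‖x - x₀‖ ^ 2 with hh
    have hhs : ContDiff ℝ ∞ h := contDiff_const.mul (hq x₀)
    have hρ : ∀ x, h x ≤ 1 → x ∈ closedBall x₀ (√T) := by
      intro x hx
      rw [mem_closedBall, dist_eq_norm]
      refine Real.le_sqrt_of_sq_le ?_
      rwa [hh, inv_mul_le_iff₀ hT, mul_one] at hx
    have hG : ∀ x ∈ closedBall x₀ (√T), ‖fderiv ℝ h x‖ ^ 2 ≤ 4 / T := by
      intro x hx
      rw [mem_closedBall, dist_eq_norm, Real.le_sqrt (norm_nonneg _) hT.le] at hx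
      rw [hh, fderiv_const_mul ((hq x₀).differentiable (by simp) x), norm_smul,
        norm_fderiv_norm_sub_sq, Real.norm_of_nonneg (by positivity), mul_pow, mul_pow]
      calc _ ≤ T⁻¹ ^ 2 * (2 ^ 2 * T) := by gcongr
        _ = 4 / T := by field_simp; norm_num
    have hvol : (volume : Measure (EuclideanSpace ℝ (Fin 1))).real (closedBall x₀ √T) = √T * v := by
      rw [Measure.addHaar_real_closedBall _ _ (Real.sqrt_nonneg _)]
      simp [hv]
    have hss : √T * √T = T := Real.mul_self_sqrt hT.le
    refine ⟨smoothCutoff h, contDiff_smoothCutoff hhs, hasCompactSupport_smoothCutoff hρ,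
      fun x hx => smoothCutoff_eq_one ?_, ?_, ?_⟩
    · rw [mem_closedBall, dist_eq_norm] at hx
      have : ‖x - x₀‖ ^ 2 ≤ r ^ 2 := by gcongr
      rw [hh, inv_mul_le_iff₀ hT]
      linarith
    · have := integral_smoothCutoff_sq_le volume hρ
      rw [hvol] at this
      calc _ ≤ √T * (√T * v) := mul_le_mul_of_nonneg_left this (Real.sqrt_nonneg _)
        _ = v * T := by rw [← mul_assoc, hss, mul_comm]
        _ ≤ _ := by gcongr; nlinarith [sq_nonneg M, mul_nonneg (sq_nonneg M) hv0]
    · have := integral_norm_fderiv_smoothCutoff_sq_le volume hhs hρ continuous_const hG hM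
      rw [setIntegral_const, hvol, smul_eq_mul] at this
      calc _ ≤ √T * (4 * M ^ 2 * (√T * v * (4 / T))) :=
            mul_le_mul_of_nonneg_left this (Real.sqrt_nonneg _)
        _ = 4 * M ^ 2 * (v * 4) * ((√T * √T) / T) := by ring
        _ = 4 * M ^ 2 * (v * 4) := by rw [hss, div_self hT.ne', mul_one]
        _ ≤ _ := by linarith
  · refine ⟨2 * v + 4 * M ^ 2 * (v * 16) + 1, by positivity, ?_⟩
    filter_upwards [eventually_ge_atTop 4, eventually_ge_atTop ((1 + r ^ 2) ^ 4)] with T hT hTr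
    have hT0 : 0 < T := by linarith
    -- The factor `1 / 2` confines the support to radius `T ^ (1 / 4)`, hence area of order `√T`,
    -- leaving room for the factor `log T` in the mass bound.
    set L : ℝ := Real.log T / 2 with hL
    have hlog : 0 < Real.log T := Real.log_pos (by linarith)
    have hL0 : 0 < L := by positivity
    have hsL : Real.log (√T) = L := Real.log_sqrt hT0.le
    have hs0 : 0 < √T := Real.sqrt_pos.2 hT0
    have hss : √T * √T = T := Real.mul_self_sqrt hT0.le
    have hs2 : 2 ≤ √T := Real.le_sqrt_of_sq_le (by linarith)
    have hp (x : EuclideanSpace ℝ (Fin 2)) : 0 < 1 + ‖x - x₀‖ ^ 2 := by positivity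
    set h : EuclideanSpace ℝ (Fin 2) → ℝ := fun x => L⁻¹ * Real.log (1 + ‖x - x₀‖ ^ 2) with hh
    have hls : ContDiff ℝ ∞ fun x => Real.log (1 + ‖x - x₀‖ ^ 2) :=
      (contDiff_const.add (hq x₀)).log fun x => (hp x).ne'
    have hhs : ContDiff ℝ ∞ h := contDiff_const.mul hls
    have hρ : ∀ x, h x ≤ 1 → x ∈ closedBall x₀ (√√T) := by
      intro x hx
      rw [mem_closedBall, dist_eq_norm]
      refine Real.le_sqrt_of_sq_le ?_
      rw [hh, inv_mul_le_iff₀ hL0, mul_one, ← hsL, Real.log_le_log_iff (hp x) hs0] at hx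
      linarith
    have hG : ∀ x ∈ closedBall x₀ (√√T),
        ‖fderiv ℝ h x‖ ^ 2 ≤ 4 / L ^ 2 * (1 + ‖x - x₀‖ ^ 2)⁻¹ := by
      intro x _
      have hd : DifferentiableAt ℝ (fun y => ‖y - x₀‖ ^ 2) x := (hq x₀).differentiable (by simp) x
      rw [hh, fderiv_const_mul (hls.differentiable (by simp) x), norm_smul,
        fderiv.log (hd.const_add 1) (hp x).ne', norm_smul, fderiv_const_add,
        norm_fderiv_norm_sub_sq, Real.norm_of_nonneg (by positivity),
        Real.norm_of_nonneg (inv_nonneg.2 (hp x).le)]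
      calc _ = 4 / L ^ 2 * (1 + ‖x - x₀‖ ^ 2)⁻¹ * (‖x - x₀‖ ^ 2 / (1 + ‖x - x₀‖ ^ 2)) := by
            have := (hp x).ne'
            field_simp
            norm_num
        _ ≤ 4 / L ^ 2 * (1 + ‖x - x₀‖ ^ 2)⁻¹ * 1 := by
            have := hp x
            gcongr
            rw [div_le_one (hp x)]
            linarith
        _ = _ := mul_one _
    have hvol : (volume : Measure (EuclideanSpace ℝ (Fin 2))).real (closedBall x₀ √√T)
        = √T * v := by
      rw [Measure.addHaar_real_closedBall _ _ (Real.sqrt_nonneg _)]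
      simp [hv]
    refine ⟨smoothCutoff h, contDiff_smoothCutoff hhs, hasCompactSupport_smoothCutoff hρ,
      fun x hx => smoothCutoff_eq_one ?_, ?_, ?_⟩
    · rw [mem_closedBall, dist_eq_norm] at hx
      -- `h ≤ 1 / 2` means `1 + ‖x - x₀‖² ≤ T ^ (1 / 4)`, whence the threshold `(1 + r²) ^ 4` for
      -- `T`.
      have h1 : 1 + ‖x - x₀‖ ^ 2 ≤ 1 + r ^ 2 := by gcongr
      have h2 := Real.log_le_log (hp x) h1
      have h3 := Real.log_le_log (by positivity) hTr
      rw [Real.log_pow] at h3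
      rw [hh, inv_mul_le_iff₀ hL0, hL]
      push_cast at h3
      linarith
    · have := integral_smoothCutoff_sq_le volume hρ
      rw [hvol] at this
      have hl2 : Real.log T ≤ 2 * √T := by
        have := Real.log_le_sub_one_of_pos hs0
        linarith
      calc _ ≤ (2 * √T) * (√T * v) :=
            mul_le_mul hl2 this (integral_nonneg fun x => sq_nonneg _) (by positivity)
        _ = 2 * v * T := by linear_combination 2 * v * hss
        _ ≤ _ := by gcongr; nlinarith [sq_nonneg M, mul_nonneg (sq_nonneg M) hv0]
    · have := integral_norm_fderiv_smoothCutoff_sq_le volume hhs hρ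
        (G := fun x => 4 / L ^ 2 * (1 + ‖x - x₀‖ ^ 2)⁻¹)
        (continuous_const.mul (Continuous.inv₀ (by fun_prop) fun x => (hp x).ne')) hG hM
      rw [integral_const_mul, integral_inv_one_add_norm_sq_closedBall volume (by simp) x₀
        (Real.sqrt_nonneg _), Real.sq_sqrt hs0.le] at this
      have hl : Real.log (1 + √T) ≤ Real.log T :=
        Real.log_le_log (by positivity) (by nlinarith)
      calc _ ≤ Real.log T * (4 * M ^ 2 * (4 / L ^ 2 * (v * Real.log (1 + √T)))) :=
            mul_le_mul_of_nonneg_left this hlog.le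
        _ ≤ Real.log T * (4 * M ^ 2 * (4 / L ^ 2 * (v * Real.log T))) := by gcongr
        _ = 4 * M ^ 2 * (v * 16) := by rw [hL]; field_simp; ring
        _ ≤ _ := by linarith

/-! ### Time cutoff -/

/-- A smooth function of time equal to `1` on `[1, T]` and to `0` outside `[1 / 2, T + 1]`. -/
noncomputable def timeCutoff (T t : ℝ) : ℝ :=
  Real.smoothTransition (2 * t - 1) * Real.smoothTransition (T + 1 - t)

theorem timeCutoff_nonneg (T t : ℝ) : 0 ≤ timeCutoff T t :=
  mul_nonneg (Real.smoothTransition.nonneg _) (Real.smoothTransition.nonneg _)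

theorem timeCutoff_le_one (T t : ℝ) : timeCutoff T t ≤ 1 :=
  mul_le_one₀ (Real.smoothTransition.le_one _) (Real.smoothTransition.nonneg _)
    (Real.smoothTransition.le_one _)

theorem timeCutoff_eq_one {T t : ℝ} (ht : t ∈ Icc 1 T) : timeCutoff T t = 1 := by
  rw [timeCutoff, Real.smoothTransition.one_of_one_le (by linarith [ht.1]),
    Real.smoothTransition.one_of_one_le (by linarith [ht.2]), one_mul]

theorem timeCutoff_eq_zero {T t : ℝ} (ht : t ∉ Icc (1 / 2) (T + 1)) : timeCutoff T t = 0 := by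
  rcases lt_or_ge t (1 / 2) with h | h
  · rw [timeCutoff, Real.smoothTransition.zero_of_nonpos (by linarith), zero_mul]
  · have : T + 1 < t := not_le.1 fun h' => ht ⟨h, h'⟩
    rw [timeCutoff, Real.smoothTransition.zero_of_nonpos (x := T + 1 - t) (by linarith), mul_zero]

theorem contDiff_timeCutoff (T : ℝ) : ContDiff ℝ ∞ (timeCutoff T) :=
  ((Real.smoothTransition.contDiff (n := ⊤)).comp
    ((contDiff_const.mul contDiff_id).sub contDiff_const)).mul
  ((Real.smoothTransition.contDiff (n := ⊤)).comp (contDiff_const.sub contDiff_id))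

/-- Only the two unit-scale transitions contribute, so the integral of the bound does not depend on
`T`. A one-sided bound suffices because it is multiplied by `e ≥ 0`. -/
theorem deriv_timeCutoff_le {M : ℝ} (hM : ∀ x, |deriv Real.smoothTransition x| ≤ M) (T t : ℝ) :
    deriv (timeCutoff T) t ≤
      (Icc 0 1).indicator (fun _ => 2 * M) t + (Icc T (T + 1)).indicator (fun _ => M) t := by
  have hs (y : ℝ) : HasDerivAt Real.smoothTransition (deriv Real.smoothTransition y) y :=
    ((Real.smoothTransition.contDiff (n := 1)).differentiable (by simp) y).hasDerivAt
  have l1 : HasDerivAt (fun t : ℝ => 2 * t - 1) (2 * 1) t :=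
    ((hasDerivAt_id t).const_mul 2).sub_const 1
  have l2 : HasDerivAt (fun t : ℝ => T + 1 - t) (-1) t := (hasDerivAt_id t).const_sub (T + 1)
  have h1 : HasDerivAt (fun t => Real.smoothTransition (2 * t - 1)) _ t :=
    HasDerivAt.comp (h₂ := Real.smoothTransition) t (hs (2 * t - 1)) l1
  have h2 : HasDerivAt (fun t => Real.smoothTransition (T + 1 - t)) _ t :=
    HasDerivAt.comp (h₂ := Real.smoothTransition) t (hs (T + 1 - t)) l2
  have h3 : HasDerivAt (timeCutoff T) _ t := h1.mul h2
  have hab {a b : ℝ} (h : |a| ≤ M) (hb : 0 ≤ b) (hb1 : b ≤ 1) : |a * b| ≤ M := by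
    rw [abs_mul, abs_of_nonneg hb]
    exact (mul_le_of_le_one_right (abs_nonneg a) hb1).trans h
  have k1 : deriv Real.smoothTransition (2 * t - 1) * Real.smoothTransition (T + 1 - t)
      ≤ (Icc 0 1).indicator (fun _ => M) t := by
    by_cases ht : t ∈ Icc (0 : ℝ) 1
    · rw [indicator_of_mem ht]
      exact (le_abs_self _).trans
        (hab (hM _) (Real.smoothTransition.nonneg _) (Real.smoothTransition.le_one _))
    · rw [indicator_of_notMem ht, Real.smoothTransition.deriv_eq_zero, zero_mul]
      exact fun h => ht ⟨by linarith [h.1], by linarith [h.2]⟩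
  have k2 : -(deriv Real.smoothTransition (T + 1 - t) * Real.smoothTransition (2 * t - 1))
      ≤ (Icc T (T + 1)).indicator (fun _ => M) t := by
    by_cases ht : t ∈ Icc T (T + 1)
    · rw [indicator_of_mem ht]
      exact (neg_le_abs _).trans
        (hab (hM _) (Real.smoothTransition.nonneg _) (Real.smoothTransition.le_one _))
    · rw [indicator_of_notMem ht, Real.smoothTransition.deriv_eq_zero, zero_mul, neg_zero]
      exact fun h => ht ⟨by linarith [h.2], by linarith [h.1]⟩
  have k3 : (Icc (0 : ℝ) 1).indicator (fun _ => 2 * M) t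
      = 2 * (Icc (0 : ℝ) 1).indicator (fun _ => M) t := by
    by_cases ht : t ∈ Icc (0 : ℝ) 1 <;> simp [ht]
  rw [h3.deriv, k3]
  linarith

/-! ### Localized energy-dissipation estimate -/

theorem integrable_indicator_const {α : Type*} [MeasurableSpace α] {μ : Measure α} {s : Set α}
    (hs : MeasurableSet s) (hμ : μ s ≠ ⊤) (c : ℝ) : Integrable (s.indicator fun _ => c) μ :=
  (integrable_indicator_iff hs).2 (integrableOn_const hμ)

/-- The local energy-dissipation estimate: on a ball where the spatial cutoff `η` equals `1`, the
time during which the dissipation exceeds `δ` is controlled by the mass and the Dirichlet energy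
of `η`. -/
theorem EnergyBalance.measure_dissipation_le {N : ℕ}
    {e : ℝ → EuclideanSpace ℝ (Fin N) → ℝ}
    {f : ℝ → EuclideanSpace ℝ (Fin N) → EuclideanSpace ℝ (Fin N)}
    {d : ℝ → EuclideanSpace ℝ (Fin N) → ℝ} (hb : EnergyBalance N e f d)
    (he : Continuous fun p : EuclideanSpace ℝ (Fin N) × ℝ => e p.2 p.1)
    (hf : Continuous fun p : EuclideanSpace ℝ (Fin N) × ℝ => f p.2 p.1)
    (hd : Continuous fun p : EuclideanSpace ℝ (Fin N) × ℝ => d p.2 p.1)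
    (he0 : ∀ t x, 0 ≤ e t x) (hd0 : ∀ t x, 0 ≤ d t x) {E B : ℝ} (hB : 0 ≤ B)
    (heE : ∀ t x, e t x ≤ E) (hfB : ∀ t x, ‖f t x‖ ^ 2 ≤ B * d t x)
    {M : ℝ} (hM0 : 0 ≤ M) (hM : ∀ x, |deriv Real.smoothTransition x| ≤ M)
    {η : EuclideanSpace ℝ (Fin N) → ℝ} (hη : ContDiff ℝ ∞ η) (hηc : HasCompactSupport η)
    {s : Set (EuclideanSpace ℝ (Fin N))}
    (hs : MeasurableSet s) (hs' : volume s ≠ ⊤) (hη1 : ∀ x ∈ s, η x = 1)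
    {A : Set ℝ} (hA : MeasurableSet A) {δ : ℝ} (hδ : ∀ t ∈ A, ∀ x ∈ s, δ ≤ d t x)
    {T : ℝ} (hT : 0 ≤ T) :
    δ / 2 * (volume.real s * volume.real (A ∩ Icc 1 T)) ≤
      E * (3 * M) * (∫ x, η x ^ 2) + 2 * B * (T + 1) * ∫ x, ‖fderiv ℝ η x‖ ^ 2 := by
  -- Squaring `η` leaves a factor `η` in the gradient term, which lets Young's inequality absorb it
  -- into `d η²`.
  set φ : EuclideanSpace ℝ (Fin N) × ℝ → ℝ := fun p => η p.1 ^ 2 * timeCutoff T p.2 with hφ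
  have hφs : ContDiff ℝ ∞ φ :=
    ((hη.comp contDiff_fst).pow 2).mul ((contDiff_timeCutoff T).comp contDiff_snd)
  have hsub : tsupport φ ⊆ tsupport η ×ˢ Icc (1 / 2) (T + 1) := by
    refine closure_minimal (fun p hp => ?_) ((isClosed_tsupport η).prod isClosed_Icc)
    refine ⟨subset_tsupport η fun h => hp ?_, not_not.1 fun h => hp ?_⟩
    · simp [hφ, h]
    · simp [hφ, timeCutoff_eq_zero h]
  have hφc : HasCompactSupport φ :=
    (hηc.prod isCompact_Icc).of_isClosed_subset (isClosed_tsupport φ) hsub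
  have hφ0 := hb φ hφs hφc fun p hp => by linarith [(hsub hp).2.1]
  have hφ' : Continuous (fderiv ℝ φ) := hφs.continuous_fderiv (by simp)
  set I : EuclideanSpace ℝ (Fin N) × ℝ → ℝ := fun p =>
    e p.2 p.1 * fderiv ℝ φ p (0, 1) - fderiv ℝ φ p (f p.2 p.1, 0) - d p.2 p.1 * φ p with hI
  have hIi : Integrable I := by
    refine Continuous.integrable_of_hasCompactSupport ?_ ?_
    · exact ((he.mul (hφ'.clm_apply continuous_const)).sub
        (hφ'.clm_apply (hf.prodMk continuous_const))).sub (hd.mul hφs.continuous)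
    · refine HasCompactSupport.intro hφc fun p hp => ?_
      have h1 : φ p = 0 := image_eq_zero_of_notMem_tsupport hp
      have h2 : fderiv ℝ φ p = 0 := not_not.1 fun h => hp (support_fderiv_subset ℝ h)
      simp [hI, h1, h2]
  have hderiv (p : EuclideanSpace ℝ (Fin N) × ℝ) (v : EuclideanSpace ℝ (Fin N)) (w : ℝ) :
      fderiv ℝ φ p (v, w) = 2 * η p.1 * fderiv ℝ η p.1 v * timeCutoff T p.2
        + η p.1 ^ 2 * (deriv (timeCutoff T) p.2 * w) := by
    have h1 : HasFDerivAt (fun q : EuclideanSpace ℝ (Fin N) × ℝ => η q.1) _ p :=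
      (hη.differentiable (by simp) p.1).hasFDerivAt.comp p hasFDerivAt_fst
    have hsnd : HasFDerivAt (Prod.snd : EuclideanSpace ℝ (Fin N) × ℝ → ℝ)
      (ContinuousLinearMap.snd ℝ (EuclideanSpace ℝ (Fin N)) ℝ) p := hasFDerivAt_snd
    have h2 : HasFDerivAt (fun q : EuclideanSpace ℝ (Fin N) × ℝ => timeCutoff T q.2) _ p :=
      ((contDiff_timeCutoff T).differentiable (by simp) p.2).hasDerivAt.comp_hasFDerivAt p hsnd
    have h3 : HasFDerivAt φ _ p := (h1.pow 2).mul h2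
    rw [h3.fderiv]
    simp
    ring
  set g : ℝ → ℝ := fun t =>
    (Icc 0 1).indicator (fun _ => 2 * M) t + (Icc T (T + 1)).indicator (fun _ => M) t with hg
  have hg1 : Integrable ((Icc (0 : ℝ) 1).indicator fun _ => 2 * M) :=
    integrable_indicator_const measurableSet_Icc (by simp) _
  have hg2 : Integrable ((Icc T (T + 1)).indicator fun _ => M) :=
    integrable_indicator_const measurableSet_Icc (by simp) _
  have hgi : Integrable g := hg1.add hg2
  have hg0 (t : ℝ) : 0 ≤ g t :=
    add_nonneg (indicator_nonneg (fun _ _ => by positivity) _)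
      (indicator_nonneg (fun _ _ => hM0) _)
  have hgint : ∫ t, g t = 3 * M := by
    rw [hg, integral_add hg1 hg2, integral_indicator measurableSet_Icc,
      integral_indicator measurableSet_Icc]
    simp
    ring
  set k : ℝ → ℝ := (Icc 0 (T + 1)).indicator fun _ => 1 with hk
  have hki : Integrable k := integrable_indicator_const measurableSet_Icc (by simp) _
  have hkint : ∫ t, k t = T + 1 := by
    rw [hk, integral_indicator measurableSet_Icc]
    simp
    linarith
  set a : ℝ → ℝ := (A ∩ Icc 1 T).indicator fun _ => 1 with ha
  have hAm : MeasurableSet (A ∩ Icc 1 T) := hA.inter measurableSet_Icc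
  have hAf : volume (A ∩ Icc 1 T) ≠ ⊤ := measure_ne_top_of_subset inter_subset_right (by simp)
  have hai : Integrable a := integrable_indicator_const hAm hAf _
  set c : EuclideanSpace ℝ (Fin N) → ℝ := s.indicator fun _ => 1 with hc
  have hci : Integrable c := integrable_indicator_const hs hs' _
  have hη2 : Integrable fun x => η x ^ 2 := by
    refine (hη.continuous.pow 2).integrable_of_hasCompactSupport ?_
    exact HasCompactSupport.intro hηc fun x hx => by simp [image_eq_zero_of_notMem_tsupport hx]
  have hD : Integrable fun x => ‖fderiv ℝ η x‖ ^ 2 := by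
    refine ((hη.continuous_fderiv (by simp)).norm.pow 2).integrable_of_hasCompactSupport ?_
    refine HasCompactSupport.intro (hηc.fderiv ℝ) fun x hx => ?_
    simp [image_eq_zero_of_notMem_tsupport hx]
  -- Since `I` integrates to zero by the energy balance, the whole estimate reduces to a pointwise
  -- inequality.
  have hpt (p : EuclideanSpace ℝ (Fin N) × ℝ) :
      δ / 2 * (c p.1 * a p.2) ≤ E * (η p.1 ^ 2 * g p.2)
        + 2 * B * (‖fderiv ℝ η p.1‖ ^ 2 * k p.2) - I p := by
    obtain ⟨x, t⟩ := p
    simp only [hI, hderiv, map_zero]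
    simp only [hφ]
    have hθ0 := timeCutoff_nonneg T t
    have hθk : timeCutoff T t ≤ k t := by
      by_cases ht : t ∈ Icc 0 (T + 1)
      · simpa [hk, ht] using timeCutoff_le_one T t
      · rw [timeCutoff_eq_zero fun h => ht ⟨by linarith [h.1], h.2⟩, hk, indicator_of_notMem ht]
    have htime : e t x * (η x ^ 2 * deriv (timeCutoff T) t) ≤ E * (η x ^ 2 * g t) := by
      have h1 : η x ^ 2 * deriv (timeCutoff T) t ≤ η x ^ 2 * g t :=
        mul_le_mul_of_nonneg_left (deriv_timeCutoff_le hM T t) (sq_nonneg _)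
      have h2 : 0 ≤ η x ^ 2 * g t := mul_nonneg (sq_nonneg _) (hg0 t)
      exact (mul_le_mul_of_nonneg_left h1 (he0 t x)).trans
        (mul_le_mul_of_nonneg_right (heE t x) h2)
    -- Young's inequality in the form `4 X Y ≤ (X + Y)²`, with `X = d η² / 2` and `Y = 2 B ‖∇η‖²`;
    -- half of the dissipation is left over.
    have hyoung : |2 * η x * fderiv ℝ η x (f t x)| ≤
        d t x * η x ^ 2 / 2 + 2 * B * ‖fderiv ℝ η x‖ ^ 2 := by
      have hdn := hd0 t x
      refine abs_le_of_sq_le_sq ?_ (by positivity)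
      have h1 : (fderiv ℝ η x (f t x)) ^ 2 ≤ ‖fderiv ℝ η x‖ ^ 2 * (B * d t x) := by
        have := (fderiv ℝ η x).le_opNorm (f t x)
        calc (fderiv ℝ η x (f t x)) ^ 2 = ‖fderiv ℝ η x (f t x)‖ ^ 2 := by simp
          _ ≤ (‖fderiv ℝ η x‖ * ‖f t x‖) ^ 2 := by gcongr
          _ = ‖fderiv ℝ η x‖ ^ 2 * ‖f t x‖ ^ 2 := mul_pow _ _ _
          _ ≤ _ := by gcongr; exact hfB t x
      calc (2 * η x * fderiv ℝ η x (f t x)) ^ 2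
          = 4 * η x ^ 2 * (fderiv ℝ η x (f t x)) ^ 2 := by ring
        _ ≤ 4 * η x ^ 2 * (‖fderiv ℝ η x‖ ^ 2 * (B * d t x)) := by gcongr
        _ ≤ _ := by
          linarith [sq_nonneg (d t x * η x ^ 2 / 2 - 2 * B * ‖fderiv ℝ η x‖ ^ 2)]
    have hflux : -(2 * η x * fderiv ℝ η x (f t x) * timeCutoff T t) ≤
        d t x * (η x ^ 2 * timeCutoff T t) / 2 + 2 * B * (‖fderiv ℝ η x‖ ^ 2 * k t) := by
      have h1 := mul_le_mul_of_nonneg_right ((neg_le_abs _).trans hyoung) hθ0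
      have h2 : 2 * B * ‖fderiv ℝ η x‖ ^ 2 * timeCutoff T t ≤ 2 * B * ‖fderiv ℝ η x‖ ^ 2 * k t := by
        gcongr
      linarith
    have hdiss : δ / 2 * (c x * a t) ≤ d t x * (η x ^ 2 * timeCutoff T t) / 2 := by
      by_cases hx : x ∈ s ∧ t ∈ A ∩ Icc 1 T
      · have := hδ t hx.2.1 x hx.1
        rw [hc, ha, indicator_of_mem hx.1, indicator_of_mem hx.2, hη1 x hx.1,
          timeCutoff_eq_one hx.2.2]
        linarith
      · have h0 : c x * a t = 0 := by
          rcases not_and_or.1 hx with h | h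
          · rw [hc, indicator_of_notMem h, zero_mul]
          · rw [ha, indicator_of_notMem h, mul_zero]
        rw [h0, mul_zero]
        have := hd0 t x
        positivity
    linarith
  have hci' : ∫ x, c x = volume.real s := by
    rw [hc, integral_indicator hs]
    simp
  have hai' : ∫ t, a t = volume.real (A ∩ Icc 1 T) := by
    rw [ha, integral_indicator hAm]
    simp
  have hi1 : Integrable (fun p : EuclideanSpace ℝ (Fin N) × ℝ => E * (η p.1 ^ 2 * g p.2)) :=
    (hη2.mul_prod hgi).const_mul E
  have hi2 : Integrable (fun p : EuclideanSpace ℝ (Fin N) × ℝ =>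
      2 * B * (‖fderiv ℝ η p.1‖ ^ 2 * k p.2)) := (hD.mul_prod hki).const_mul (2 * B)
  have hint : ∫ p : EuclideanSpace ℝ (Fin N) × ℝ, δ / 2 * (c p.1 * a p.2) ≤
      ∫ p : EuclideanSpace ℝ (Fin N) × ℝ, (E * (η p.1 ^ 2 * g p.2)
        + 2 * B * (‖fderiv ℝ η p.1‖ ^ 2 * k p.2) - I p) :=
    integral_mono ((hci.mul_prod hai).const_mul (δ / 2)) ((hi1.add hi2).sub hIi) hpt
  rw [integral_sub (f := fun p => _ + _) (hi1.add hi2) hIi, hφ0, integral_add hi1 hi2, integral_const_mul,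
    integral_const_mul, integral_const_mul, Measure.volume_eq_prod, integral_prod_mul,
    integral_prod_mul (fun x => η x ^ 2), integral_prod_mul (fun x => ‖fderiv ℝ η x‖ ^ 2),
    hci', hai', hgint, hkint] at hint
  linarith

/-! ### Occupation times of trajectories -/

theorem Psi_nonneg {N : ℕ} {T : ℝ} (hT : 1 ≤ T) : 0 ≤ Psi N T := by
  unfold Psi
  split
  · exact Real.sqrt_nonneg _
  · exact Real.log_nonneg hT
  · exact zero_le_one

theorem Psi_le_self {N : ℕ} {T : ℝ} (hT : 1 ≤ T) : Psi N T ≤ T := by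
  unfold Psi
  split
  · exact Real.sqrt_le_iff.2 ⟨by linarith, by nlinarith⟩
  · linarith [Real.log_le_sub_one_of_pos (by linarith : 0 < T)]
  · exact hT

namespace ExtendedDissipativeSystem

variable {N : ℕ} {X : Type*} [TopologicalSpace X] (S : ExtendedDissipativeSystem N X)

theorem exists_dissipation_pos {u : X} (hu : ¬ S.IsEquilibrium u) : ∃ x, 0 < S.d u x := by
  by_contra! h
  exact hu (S.eq_of_dissipation_zero u fun x => le_antisymm (h x) bot_le)

theorem continuous_trajectory (u : X) : Continuous fun t : ℝ => S.Φ t.toNNReal u :=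
  S.Φ.continuous continuous_real_toNNReal continuous_const

/-- A trajectory of a bounded system spends time `O(T / Ψ_N(T))` up to time `T` among the states
that dissipate at least `δ` on a fixed ball. -/
theorem exists_eventually_measure_le (hN₁ : 1 ≤ N) (hN₂ : N ≤ 2) (hS : S.IsBounded)
    {V : Set X} (hV : IsOpen V) {x₀ : EuclideanSpace ℝ (Fin N)} {r : ℝ} (hr : 0 < r) {δ : ℝ≥0}
    (hδ : 0 < δ) (hVδ : ∀ u ∈ V, ∀ x ∈ closedBall x₀ r, δ ≤ S.d u x) :
    ∃ K : ℝ, ∀ u₀ : X, ∀ᶠ T : ℝ in atTop,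
      Psi N T * volume.real ({t : ℝ | S.Φ t.toNNReal u₀ ∈ V} ∩ Icc 1 T) ≤ K * T := by
  obtain ⟨E, hE, hSE⟩ := hS
  obtain ⟨b, hbm, hb⟩ := S.flux_bound
  obtain ⟨M, hM0, hM⟩ := Real.smoothTransition.exists_abs_deriv_le
  obtain ⟨C, hC, hη⟩ := exists_cutoff hN₁ hN₂ x₀ hr
  -- Monotonicity of `b` turns the energy bound into one constant valid along all trajectories.
  set B : ℝ≥0 := b E.toNNReal
  set m : ℝ := δ / 2 * volume.real (closedBall x₀ r)
  have hm : 0 < m := mul_pos (by positivity)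
    (ENNReal.toReal_pos (measure_closedBall_pos _ _ hr).ne' measure_closedBall_lt_top.ne)
  refine ⟨(E * (3 * M) * C + 4 * B * C) / m, fun u₀ => ?_⟩
  filter_upwards [hη, eventually_ge_atTop 1] with T ⟨η, hηs, hηc, hη1, hη2, hηD⟩ hT
  have hu : Continuous fun p : EuclideanSpace ℝ (Fin N) × ℝ => S.Φ p.2.toNNReal u₀ :=
    (S.continuous_trajectory u₀).comp continuous_snd
  have key := (S.energy_balance u₀).measure_dissipation_le
    (NNReal.continuous_coe.comp ((S.continuous_e.comp hu).eval continuous_fst))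
    ((S.continuous_f.comp hu).eval continuous_fst)
    (NNReal.continuous_coe.comp ((S.continuous_d.comp hu).eval continuous_fst))
    (fun _ _ => NNReal.coe_nonneg _) (fun _ _ => NNReal.coe_nonneg _) (B := B) B.coe_nonneg
    (fun _ _ => hSE _ _)
    (fun t x => (hb _ x).trans (mul_le_mul_of_nonneg_right
      (NNReal.coe_le_coe.2 (hbm (NNReal.le_toNNReal_of_coe_le (hSE _ x)))) (NNReal.coe_nonneg _)))
    hM0.le hM hηs hηc measurableSet_closedBall measure_closedBall_lt_top.ne hη1
    (A := {t : ℝ | S.Φ t.toNNReal u₀ ∈ V})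
    (hV.preimage (S.continuous_trajectory u₀)).measurableSet (δ := δ)
    (fun t ht x hx => NNReal.coe_le_coe.2 (hVδ _ ht x hx)) (T := T) (by linarith)
  set a : ℝ := volume.real ({t : ℝ | S.Φ t.toNNReal u₀ ∈ V} ∩ Icc 1 T)
  have hΨ := Psi_nonneg (N := N) hT
  rw [div_mul_eq_mul_div, le_div_iff₀ hm]
  calc Psi N T * a * m = Psi N T * (δ / 2 * (volume.real (closedBall x₀ r) * a)) := by ring
    _ ≤ Psi N T * (E * (3 * M) * (∫ x, η x ^ 2)
          + 2 * B * (T + 1) * ∫ x, ‖fderiv ℝ η x‖ ^ 2) := mul_le_mul_of_nonneg_left key hΨ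
    _ = E * (3 * M) * (Psi N T * ∫ x, η x ^ 2)
          + 2 * B * (T + 1) * (Psi N T * ∫ x, ‖fderiv ℝ η x‖ ^ 2) := by ring
    -- Here `T + 1 ≤ T + T`, as `T ≥ 1`.
    _ ≤ E * (3 * M) * (C * T) + 2 * B * (T + T) * C := by gcongr
    _ = _ := by ring

/-- The time cutoff equals `1` only from time `1` on, so the initial unit interval is counted in
full. -/
theorem integral_indicator_trajectory_le (u₀ : X) {V : Set X} (hV : IsOpen V) {T : ℝ}
    (hT : 1 ≤ T) :
    ∫ t in (0 : ℝ)..T, V.indicator (fun _ => (1 : ℝ)) (S.Φ t.toNNReal u₀) ≤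
      1 + volume.real ({t : ℝ | S.Φ t.toNNReal u₀ ∈ V} ∩ Icc 1 T) := by
  set A : Set ℝ := {t : ℝ | S.Φ t.toNNReal u₀ ∈ V} with hA
  have hAm : MeasurableSet A := (hV.preimage (S.continuous_trajectory u₀)).measurableSet
  have h1 : (fun t : ℝ => V.indicator (fun _ => (1 : ℝ)) (S.Φ t.toNNReal u₀))
      = A.indicator fun _ => 1 := rfl
  rw [intervalIntegral.integral_of_le (by linarith), h1, integral_indicator hAm,
    Measure.restrict_restrict hAm, setIntegral_const, smul_eq_mul, mul_one]
  have hsub : A ∩ Ioc 0 T ⊆ Icc 0 1 ∪ A ∩ Icc 1 T := by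
    rintro t ⟨htA, ht⟩
    rcases le_total t 1 with h | h
    · exact Or.inl ⟨ht.1.le, h⟩
    · exact Or.inr ⟨htA, h, ht.2⟩
  have hfin : volume (A ∩ Icc 1 T) ≠ ⊤ := measure_ne_top_of_subset inter_subset_right (by simp)
  calc volume.real (A ∩ Ioc 0 T) ≤ volume.real (Icc 0 1 ∪ A ∩ Icc 1 T) :=
        measureReal_mono hsub (measure_union_ne_top (by simp) hfin)
    _ ≤ volume.real (Icc (0 : ℝ) 1) + volume.real (A ∩ Icc 1 T) := measureReal_union_le _ _
    _ = _ := by simp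

end ExtendedDissipativeSystem

theorem proposition5p1 {X : Type*} [TopologicalSpace X] [TopologicalSpace.MetrizableSpace X]
    {N : ℕ} (hN₁ : 1 ≤ N) (hN₂ : N ≤ 2)
    (S : ExtendedDissipativeSystem N X) (hS : S.IsBounded)
    (u' : X) (hu' : ¬ S.IsEquilibrium u') :
    ∃ V : Set X, IsOpen V ∧ u' ∈ V ∧ ∀ u₀ : X,
      Filter.limsup
        (fun T : ℝ =>
          ((Psi N T / T *
            ∫ t in (0 : ℝ)..T, V.indicator (fun _ => (1 : ℝ)) (S.Φ t.toNNReal u₀) : ℝ) : EReal))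
        Filter.atTop < ⊤ := by
  obtain ⟨x₀, hx₀⟩ := S.exists_dissipation_pos hu'
  obtain ⟨δ, hδ, hδx⟩ := exists_between hx₀
  obtain ⟨r, hr, hrδ⟩ := nhds_basis_closedBall.mem_iff.1
    ((isOpen_Ioi.preimage (S.d u').continuous).mem_nhds (show x₀ ∈ S.d u' ⁻¹' Ioi δ from hδx))
  -- Sending a compact set into an open one is an open condition in the compact-open topology, hence
  -- the closed ball and the strict inequality.
  set V : Set X := {u | MapsTo (S.d u) (closedBall x₀ r) (Ioi δ)} with hVdef
  have hV : IsOpen V :=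
    (ContinuousMap.isOpen_setOfPred_mapsTo (isCompact_closedBall x₀ r) isOpen_Ioi).preimage
      S.continuous_d
  refine ⟨V, hV, hrδ, ?_⟩
  obtain ⟨K, hK⟩ := S.exists_eventually_measure_le hN₁ hN₂ hS hV hr hδ
    (fun u hu x hx => le_of_lt (hu hx))
  intro u₀
  -- The `1` pays for the times in `[0, 1]`, using `Ψ_N(T) ≤ T`; `K` does not depend on `u₀`.
  refine (limsup_le_of_le (a := ((1 + K : ℝ) : EReal)) (by isBoundedDefault) ?_).trans_lt
    (EReal.coe_lt_top _)
  filter_upwards [hK u₀, eventually_ge_atTop 1] with T hKT hT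
  rw [EReal.coe_le_coe_iff, div_mul_eq_mul_div, div_le_iff₀ (by linarith)]
  have h1 := mul_le_mul_of_nonneg_left (S.integral_indicator_trajectory_le u₀ hV hT)
    (Psi_nonneg (N := N) hT)
  have h2 := Psi_le_self (N := N) hT
  linarith
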